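/- **Setting.** Let $R$ be an associative unital ring (not necessarily commutative) and $n\ge 0$. *Quasi-determinants.* For a matrix $A=(a_{ij})$ over $R$ and finite index sets $I\ni i$, $K\ni j$ with $|I|=|K|$, the quasi-determinant $|A^I_K|_{ij}$ of the submatrix $A^I_K$ with rows $I$ and columns $K$ is well defined if $B:=A^{I\setminus\{i\}}_{K\setminus\{j\}}$ is invertible, and then $$|A^I_K|_{ij}=a_{ij}-\sum_{k\in K\setminus\{j\},\;l\in I\setminus\{i\}}a_{ik}\,(B^{-1})_{kl}\,a_{lj}.$$ The left and right quasi-Plücker coordinates are $$q^{J}_{ij}(A^I)=\bigl(|A^I_{\{i\}\cup J}|_{si}\bigr)^{-1}|A^I_{\{j\}\cup J}|_{sj}\ (i\notin J),\qquad r^{J}_{ij}(A_K)=|A^{\{i\}\cup J}_K|_{it}\bigl(|A^{\{j\}\cup J}_K|_{jt}\bigr)^{-1}\ (j\notin J),$$ for any $s\in I$ (resp. $t\in K$) for which the two quasi-determinants are well defined and the inverted one is invertible; the value does not depend on this choice, and the coordinate is called well defined if such a choice exists. *L-operators.* Consider pairs $\mathbf L^{(a)}=(\mathbf L^{+(a)},\mathbf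 L^{-(a)})$, $a=1,2$, of $n\times n$ matrices over $R$ with $\mathbf L^{+(a)}$ upper triangular, $\mathbf L^{-(a)}$ lower triangular, $\mathbf L^{+(a)}_{ii}=\mathbf u^{(a)}_i$, $\mathbf L^{-(a)}_{ii}=\mathbf u^{(a)}_{i-1}$, $\mathbf u^{(a)}_0=1$ and all $\mathbf u^{(a)}_i$ invertible; likewise $\widetilde{\mathbf L}^{(a)}$ with $\widetilde{\mathbf u}^{(a)}_i$. The zero-curvature relation is $$\mathbf L^{+(1)}\mathbf L^{+(2)}=\widetilde{\mathbf L}^{+(2)}\widetilde{\mathbf L}^{+(1)},\quad \mathbf L^{-(1)}\mathbf L^{+(2)}=\widetilde{\mathbf L}^{+(2)}\widetilde{\mathbf L}^{-(1)},\quad \mathbf L^{-(1)}\mathbf L^{-(2)}=\widetilde{\mathbf L}^{-(2)}\widetilde{\mathbf L}^{-(1)}.\tag{ZC}$$ Put $\mathbf J=\mathbf L^{-(1)}\mathbf L^{+(2)}$, $\widetilde{\mathbf J}=\widetilde{\mathbf L}^{+(2)}\widetilde{\mathbf L}^{-(1)}$ and $$\mathbf M=\begin{pmatrix}0&\mathbf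 L^{-(1)}\mathbf L^{-(2)}\\ \mathbf L^{+(1)}\mathbf L^{+(2)}&\mathbf J\end{pmatrix},\qquad \widetilde{\mathbf M}=\begin{pmatrix}0&\widetilde{\mathbf L}^{+(2)}\widetilde{\mathbf L}^{+(1)}\\ \widetilde{\mathbf L}^{-(2)}\widetilde{\mathbf L}^{-(1)}&\widetilde{\mathbf J}\end{pmatrix},$$ with rows and columns indexed by $\bar1,\dots,\bar n,1,\dots,n$. Write $\overrightarrow{\prod}_{k=1}^{m}x_k=x_1\cdots x_m$ and $\overleftarrow{\prod}_{k=1}^{m}x_k=x_m\cdots x_1$. Abbreviate $q_{k;ab}=q^{k+1,\dots,n}_{ab}(\mathbf M^{k,\dots,n})$, $r_{k;ab}=r^{k+1,\dots,n}_{ab}(\mathbf M_{k,\dots,n})$, $\widetilde q_{k;ab}=q^{1,\dots,k-1}_{ab}(\widetilde{\mathbf M}^{1,\dots,k})$, $\widetilde r_{k;ab}=r^{1,\dots,k-1}_{ab}(\widetilde{\mathbf M}_{1,\dots,k})$, where the left coordinates use all columns, and the right coordinates all rows, of the block matrix. *Forward map* $F:(\mathbf L^{(1)},\mathbf L^{(2)})\mapsto(\widetilde{\mathbf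 L}^{(1)},\widetilde{\mathbf L}^{(2)})$: for $1\le i\le j\le n$ (entries outside the triangles are $0$) $$\widetilde{\mathbf L}^{+(1)}_{ij}=\Bigl(\overrightarrow{\prod_{k=1}^{i-1}}q_{k;k\bar k}\Bigr)q_{i;i\bar j},\quad \widetilde{\mathbf L}^{-(1)}_{ji}=\Bigl(\overrightarrow{\prod_{k=1}^{j-1}}q_{k;k\bar k}\Bigr)q_{j;ji},\quad \widetilde{\mathbf L}^{+(2)}_{ij}=r_{j;i\bar j}\overleftarrow{\prod_{k=1}^{j-1}}r_{k;k\bar k},\quad \widetilde{\mathbf L}^{-(2)}_{ji}=r_{i;\bar j\bar i}\overleftarrow{\prod_{k=1}^{i-1}}r_{k;k\bar k}.$$ Its domain $D$ consists of the $(\mathbf L^{(1)},\mathbf L^{(2)})$ as above such that all $|\mathbf J^{k,\dots,n}_{k,\dots,n}|_{kk}$, $1\le k\le n$, are well defined and invertible. *Backward map* $G:(\widetilde{\mathbf L}^{(1)},\widetilde{\mathbf L}^{(2)})\mapsto(\mathbf L^{(1)},\mathbf L^{(2)})$: for $1\le i\le j\le n$ (entries outside the triangles are $0$) $$\mathbf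 L^{+(1)}_{ij}=\widetilde r_{j;\bar i j}\overleftarrow{\prod_{k=1}^{j-1}}\widetilde r_{k;\bar k k},\quad \mathbf L^{-(1)}_{ji}=\widetilde r_{i;ji}\overleftarrow{\prod_{k=1}^{i-1}}\widetilde r_{k;\bar k k},\quad \mathbf L^{+(2)}_{ij}=\Bigl(\overrightarrow{\prod_{k=1}^{i-1}}\widetilde q_{k;\bar k k}\Bigr)\widetilde q_{i;\bar i j},\quad \mathbf L^{-(2)}_{ji}=\Bigl(\overrightarrow{\prod_{k=1}^{j-1}}\widetilde q_{k;\bar k k}\Bigr)\widetilde q_{j;\bar j\bar i}.$$ Its domain $\widetilde D$ consists of the $(\widetilde{\mathbf L}^{(1)},\widetilde{\mathbf L}^{(2)})$ as above such that all $|\widetilde{\mathbf J}^{1,\dots,k}_{1,\dots,k}|_{kk}$, $1\le k\le n$, are well defined and invertible. **Theorem.** All quasi-Plücker coordinates in the formulas for $F$ on $D$ and for $G$ on $\widetilde D$ are well defined. The map $G$ sends $\widetilde D$ into $D$, the map $F$ sends $D$ into $\widetilde D$, and $G$ is the inverse map of $F$: $F(G(Y))=Y$ for all $Y\in\widetilde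 D$ and $G(F(X))=X$ for all $X\in D$. Moreover the zero-curvature relation (ZC) holds between $G(Y)$ and $Y$ for every $Y\in\widetilde D$, and between $X$ and $F(X)$ for every $X\in D$. -/

import Mathlib

open scoped Classical in
/-- `X` restricts to a two-sided inverse of the submatrix of `A` with rows `I` and columns `K`
(entries of `X` outside `K × I` play no role). -/
def IsBlockInv {R ι κ : Type*} [Ring R] (A : Matrix ι κ R) (I : Finset ι) (K : Finset κ)
    (X : Matrix κ ι R) : Prop :=
  (∀ l ∈ I, ∀ l' ∈ I, ∑ k ∈ K, A l k * X k l' = if l = l' then 1 else 0) ∧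
  (∀ k ∈ K, ∀ k' ∈ K, ∑ l ∈ I, X k l * A l k' = if k = k' then 1 else 0)

open scoped Classical in
/-- The inverse of the submatrix of `A` with rows `I` and columns `K`; zero if there is none. -/
noncomputable def blockInv {R ι κ : Type*} [Ring R] (A : Matrix ι κ R) (I : Finset ι)
    (K : Finset κ) : Matrix κ ι R :=
  if h : ∃ X, IsBlockInv A I K X then h.choose else 0

/-- The quasi-determinant `|A^I_K|_{ij}` of the square submatrix with rows `I ∋ i` and columns
`K ∋ j` is well defined: deleting row `i` and column `j` leaves an invertible matrix. -/
def QuasidetDefined {R ι κ : Type*} [Ring R] [DecidableEq ι] [DecidableEq κ]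
    (A : Matrix ι κ R) (I : Finset ι) (K : Finset κ) (i : ι) (j : κ) : Prop :=
  i ∈ I ∧ j ∈ K ∧ I.card = K.card ∧ ∃ X, IsBlockInv A (I.erase i) (K.erase j) X

/-- The quasi-determinant `|A^I_K|_{ij} = a_{ij} - ∑_{k ≠ j, l ≠ i} a_{ik} ((A^{ij})⁻¹)_{kl} a_{lj}`
of the submatrix of `A` with rows `I` and columns `K`. -/
noncomputable def quasidet {R ι κ : Type*} [Ring R] [DecidableEq ι] [DecidableEq κ]
    (A : Matrix ι κ R) (I : Finset ι) (K : Finset κ) (i : ι) (j : κ) : R :=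
  A i j - ∑ k ∈ K.erase j, ∑ l ∈ I.erase i,
    A i k * blockInv A (I.erase i) (K.erase j) k l * A l j

/-- The row `s` can be used to compute the left quasi-Plücker coordinate `q^J_{ij}(A^I)`. -/
def LeftQPAdmissible {R ι κ : Type*} [Ring R] [DecidableEq ι] [DecidableEq κ]
    (A : Matrix ι κ R) (I : Finset ι) (J : Finset κ) (i j : κ) (s : ι) : Prop :=
  i ∉ J ∧ QuasidetDefined A I (insert i J) s i ∧ QuasidetDefined A I (insert j J) s j ∧
    IsUnit (quasidet A I (insert i J) s i)

/-- The column `t` can be used to compute the right quasi-Plücker coordinate `r^J_{ij}(A_K)`. -/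
def RightQPAdmissible {R ι κ : Type*} [Ring R] [DecidableEq ι] [DecidableEq κ]
    (A : Matrix ι κ R) (K : Finset κ) (J : Finset ι) (i j : ι) (t : κ) : Prop :=
  j ∉ J ∧ QuasidetDefined A (insert i J) K i t ∧ QuasidetDefined A (insert j J) K j t ∧
    IsUnit (quasidet A (insert j J) K j t)

/-- The left quasi-Plücker coordinate `q^J_{ij}(A^I)` is well defined. -/
def LeftQPDefined {R ι κ : Type*} [Ring R] [DecidableEq ι] [DecidableEq κ]
    (A : Matrix ι κ R) (I : Finset ι) (J : Finset κ) (i j : κ) : Prop :=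
  ∃ s, LeftQPAdmissible A I J i j s

/-- The right quasi-Plücker coordinate `r^J_{ij}(A_K)` is well defined. -/
def RightQPDefined {R ι κ : Type*} [Ring R] [DecidableEq ι] [DecidableEq κ]
    (A : Matrix ι κ R) (K : Finset κ) (J : Finset ι) (i j : ι) : Prop :=
  ∃ t, RightQPAdmissible A K J i j t

open scoped Classical in
/-- The left quasi-Plücker coordinate
`q^J_{ij}(A^I) = (|A^I_{i,J}|_{si})⁻¹ |A^I_{j,J}|_{sj}` of the matrix formed by the rows `I` of `A`,
for any admissible `s` (see `leftQP_eq` for the independence of `s`). -/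
noncomputable def leftQP {R ι κ : Type*} [Ring R] [DecidableEq ι] [DecidableEq κ]
    (A : Matrix ι κ R) (I : Finset ι) (J : Finset κ) (i j : κ) : R :=
  if h : LeftQPDefined A I J i j then
    Ring.inverse (quasidet A I (insert i J) h.choose i) * quasidet A I (insert j J) h.choose j
  else 0

open scoped Classical in
/-- The right quasi-Plücker coordinate
`r^J_{ij}(A_K) = |A^{i,J}_K|_{it} (|A^{j,J}_K|_{jt})⁻¹` of the matrix formed by the columns `K` of
`A`, for any admissible `t` (see `rightQP_eq` for the independence of `t`). -/
noncomputable def rightQP {R ι κ : Type*} [Ring R] [DecidableEq ι] [DecidableEq κ]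
    (A : Matrix ι κ R) (K : Finset κ) (J : Finset ι) (i j : ι) : R :=
  if h : RightQPDefined A K J i j then
    quasidet A (insert i J) K i h.choose * Ring.inverse (quasidet A (insert j J) K j h.choose)
  else 0

theorem blockInv_spec {R ι κ : Type*} [Ring R] {A : Matrix ι κ R} {I : Finset ι}
    {K : Finset κ} (h : ∃ X, IsBlockInv A I K X) : IsBlockInv A I K (blockInv A I K) := by
  unfold blockInv
  rw [dif_pos h]
  exact h.choose_spec

/-- A row vector annihilating the columns `J` is determined by its entry at `s`, and its value on a
further column is that entry times a quasi-determinant. -/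
theorem left_aux {R ι κ : Type*} [Ring R] [DecidableEq ι] [DecidableEq κ]
    (A : Matrix ι κ R) (I : Finset ι) (J : Finset κ) (j : κ) (s : ι) (hj : j ∉ J)
    (hs : s ∈ I) (h : ∃ X, IsBlockInv A (I.erase s) J X) (v : ι → R)
    (hv : ∀ k ∈ J, ∑ l ∈ I, v l * A l k = 0) :
    ∑ l ∈ I, v l * A l j = v s * quasidet A I (insert j J) s j := by
  have hX := blockInv_spec h
  unfold quasidet
  rw [Finset.erase_insert hj]
  set X := blockInv A (I.erase s) J with hXdef
  have key : ∀ l ∈ I.erase s, v l = - ∑ k ∈ J, v s * A s k * X k l := by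
    intro l hl
    have h1 : ∑ k ∈ J, (∑ l' ∈ I, v l' * A l' k) * X k l = 0 :=
      Finset.sum_eq_zero fun k hk => by rw [hv k hk, zero_mul]
    have h2 : ∑ k ∈ J, (∑ l' ∈ I.erase s, v l' * A l' k) * X k l = v l := by
      simp_rw [Finset.sum_mul]
      rw [Finset.sum_comm]
      have : ∀ l' ∈ I.erase s, ∑ k ∈ J, v l' * A l' k * X k l = if l' = l then v l' else 0 := by
        intro l' hl'
        have := hX.1 l' hl' l hl
        simp_rw [mul_assoc, ← Finset.mul_sum, this]
        split_ifs <;> simp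
      rw [Finset.sum_congr rfl this, Finset.sum_ite_eq' (I.erase s) l v, if_pos hl]
    simp_rw [← Finset.add_sum_erase I _ hs, add_mul, Finset.sum_add_distrib] at h1
    rw [h2] at h1
    exact eq_neg_of_add_eq_zero_right h1
  rw [← Finset.add_sum_erase I _ hs,
    Finset.sum_congr rfl fun l hl => by rw [key l hl], mul_sub, sub_eq_add_neg]
  congr 1
  simp_rw [neg_mul, Finset.sum_neg_distrib, Finset.mul_sum, Finset.sum_mul]
  rw [Finset.sum_comm]
  simp_rw [mul_assoc]

theorem right_aux {R ι κ : Type*} [Ring R] [DecidableEq ι] [DecidableEq κ]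
    (A : Matrix ι κ R) (K : Finset κ) (J : Finset ι) (j : ι) (t : κ) (hj : j ∉ J)
    (ht : t ∈ K) (h : ∃ X, IsBlockInv A J (K.erase t) X) (v : κ → R)
    (hv : ∀ l ∈ J, ∑ k ∈ K, A l k * v k = 0) :
    ∑ k ∈ K, A j k * v k = quasidet A (insert j J) K j t * v t := by
  have hX := blockInv_spec h
  unfold quasidet
  rw [Finset.erase_insert hj]
  set X := blockInv A J (K.erase t) with hXdef
  have key : ∀ k ∈ K.erase t, v k = - ∑ l ∈ J, X k l * (A l t * v t) := by
    intro k hk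
    have h1 : ∑ l ∈ J, X k l * (∑ k' ∈ K, A l k' * v k') = 0 :=
      Finset.sum_eq_zero fun l hl => by rw [hv l hl, mul_zero]
    have h2 : ∑ l ∈ J, X k l * (∑ k' ∈ K.erase t, A l k' * v k') = v k := by
      simp_rw [Finset.mul_sum]
      rw [Finset.sum_comm]
      have : ∀ k' ∈ K.erase t, ∑ l ∈ J, X k l * (A l k' * v k') = if k = k' then v k' else 0 := by
        intro k' hk'
        have := hX.2 k hk k' hk'
        simp_rw [← mul_assoc, ← Finset.sum_mul, this]
        split_ifs <;> simp
      rw [Finset.sum_congr rfl this, Finset.sum_ite_eq (K.erase t) k v, if_pos hk]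
    simp_rw [← Finset.add_sum_erase K _ ht, mul_add, Finset.sum_add_distrib] at h1
    rw [h2] at h1
    exact eq_neg_of_add_eq_zero_right h1
  rw [← Finset.add_sum_erase K _ ht,
    Finset.sum_congr rfl fun k hk => by rw [key k hk], sub_mul, sub_eq_add_neg]
  congr 1
  simp_rw [mul_neg, Finset.sum_neg_distrib, Finset.mul_sum, Finset.sum_mul, mul_assoc]

theorem exists_left_row {R ι κ : Type*} [Ring R] [DecidableEq ι] [DecidableEq κ]
    (A : Matrix ι κ R) (I : Finset ι) (J : Finset κ) (s : ι)
    (hs : s ∈ I) (h : ∃ X, IsBlockInv A (I.erase s) J X) :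
    ∃ v : ι → R, v s = 1 ∧ ∀ k ∈ J, ∑ l ∈ I, v l * A l k = 0 := by
  obtain ⟨X, hX⟩ := h
  refine ⟨fun l => if l = s then 1 else - ∑ k ∈ J, A s k * X k l, by simp, fun k hk => ?_⟩
  rw [← Finset.add_sum_erase I _ hs]
  have : ∀ l ∈ I.erase s, (if l = s then (1 : R) else - ∑ k ∈ J, A s k * X k l) * A l k
      = - ∑ k' ∈ J, A s k' * (X k' l * A l k) := by
    intro l hl
    rw [if_neg (Finset.ne_of_mem_erase hl), neg_mul, Finset.sum_mul]
    simp_rw [mul_assoc]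
  rw [Finset.sum_congr rfl this, Finset.sum_neg_distrib, Finset.sum_comm]
  have : ∀ k' ∈ J, ∑ l ∈ I.erase s, A s k' * (X k' l * A l k) = if k' = k then A s k' else 0 := by
    intro k' hk'
    rw [← Finset.mul_sum, hX.2 k' hk' k hk]
    split_ifs <;> simp
  rw [Finset.sum_congr rfl this, Finset.sum_ite_eq' J k, if_pos hk]
  simp

theorem exists_right_col {R ι κ : Type*} [Ring R] [DecidableEq ι] [DecidableEq κ]
    (A : Matrix ι κ R) (K : Finset κ) (J : Finset ι) (t : κ)
    (ht : t ∈ K) (h : ∃ X, IsBlockInv A J (K.erase t) X) :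
    ∃ v : κ → R, v t = 1 ∧ ∀ l ∈ J, ∑ k ∈ K, A l k * v k = 0 := by
  obtain ⟨X, hX⟩ := h
  refine ⟨fun k => if k = t then 1 else - ∑ l ∈ J, X k l * A l t, by simp, fun l hl => ?_⟩
  rw [← Finset.add_sum_erase K _ ht]
  have : ∀ k ∈ K.erase t, A l k * (if k = t then (1 : R) else - ∑ l ∈ J, X k l * A l t)
      = - ∑ l' ∈ J, A l k * X k l' * A l' t := by
    intro k hk
    rw [if_neg (Finset.ne_of_mem_erase hk), mul_neg, Finset.mul_sum]
    simp_rw [mul_assoc]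
  rw [Finset.sum_congr rfl this, Finset.sum_neg_distrib, Finset.sum_comm]
  have : ∀ l' ∈ J, ∑ k ∈ K.erase t, A l k * X k l' * A l' t = if l = l' then A l' t else 0 := by
    intro l' hl'
    rw [← Finset.sum_mul, hX.1 l hl l' hl']
    split_ifs <;> simp
  rw [Finset.sum_congr rfl this, Finset.sum_ite_eq J l, if_pos hl]
  simp

/-- A left quasi-Plücker coordinate does not depend on the row used to compute it. -/
theorem leftQP_eq {R ι κ : Type*} [Ring R] [DecidableEq ι] [DecidableEq κ]
    {A : Matrix ι κ R} {I : Finset ι} {J : Finset κ} {i j : κ} {s : ι}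
    (h : LeftQPAdmissible A I J i j s) :
    leftQP A I J i j =
      Ring.inverse (quasidet A I (insert i J) s i) * quasidet A I (insert j J) s j := by
  have hd : LeftQPDefined A I J i j := ⟨s, h⟩
  unfold leftQP
  rw [dif_pos hd]
  have h' := hd.choose_spec
  set s' := hd.choose
  obtain ⟨hi, ⟨hs, -, hc1, hX⟩, ⟨-, -, hc2, -⟩, hu⟩ := h
  obtain ⟨-, ⟨hs', -, -, hX'⟩, -, hu'⟩ := h'
  have hj : j ∉ J := by
    intro hj
    rw [Finset.insert_eq_of_mem hj] at hc2
    rw [Finset.card_insert_of_notMem hi] at hc1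
    omega
  rw [Finset.erase_insert hi] at hX hX'
  obtain ⟨v, hv1, hv⟩ := exists_left_row A I J s hs hX
  have a1 := left_aux A I J i s hi hs hX v hv
  have a2 := left_aux A I J j s hj hs hX v hv
  have b1 := left_aux A I J i s' hi hs' hX' v hv
  have b2 := left_aux A I J j s' hj hs' hX' v hv
  rw [hv1, one_mul] at a1 a2
  rw [← a2, ← a1, b1, b2]
  have hu2 : IsUnit (v s' * quasidet A I (insert i J) s' i) := by rw [← b1, a1]; exact hu
  generalize quasidet A I (insert j J) s' j = y
  obtain ⟨d, hd'⟩ := hu'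
  rw [← hd'] at hu2 ⊢
  obtain ⟨w, hw⟩ := hu2
  have hvs : v s' = ((w * d⁻¹ : Rˣ) : R) := by rw [Units.val_mul, hw]; simp
  rw [hvs, ← Units.val_mul, Ring.inverse_unit, Ring.inverse_unit, ← mul_assoc, ← Units.val_mul]
  simp

/-- A right quasi-Plücker coordinate does not depend on the column used to compute it. -/
theorem rightQP_eq {R ι κ : Type*} [Ring R] [DecidableEq ι] [DecidableEq κ]
    {A : Matrix ι κ R} {K : Finset κ} {J : Finset ι} {i j : ι} {t : κ}
    (h : RightQPAdmissible A K J i j t) :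
    rightQP A K J i j =
      quasidet A (insert i J) K i t * Ring.inverse (quasidet A (insert j J) K j t) := by
  have hd : RightQPDefined A K J i j := ⟨t, h⟩
  unfold rightQP
  rw [dif_pos hd]
  have h' := hd.choose_spec
  set t' := hd.choose
  obtain ⟨hj, ⟨-, -, hc2, -⟩, ⟨-, ht, hc1, hX⟩, hu⟩ := h
  obtain ⟨-, -, ⟨-, ht', -, hX'⟩, hu'⟩ := h'
  have hi : i ∉ J := by
    intro hi
    rw [Finset.insert_eq_of_mem hi] at hc2
    rw [Finset.card_insert_of_notMem hj] at hc1
    omega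
  rw [Finset.erase_insert hj] at hX hX'
  obtain ⟨v, hv1, hv⟩ := exists_right_col A K J t ht hX
  have a1 := right_aux A K J i t hi ht hX v hv
  have a2 := right_aux A K J j t hj ht hX v hv
  have b1 := right_aux A K J i t' hi ht' hX' v hv
  have b2 := right_aux A K J j t' hj ht' hX' v hv
  rw [hv1, mul_one] at a1 a2
  rw [← a2, ← a1, b1, b2]
  have hu2 : IsUnit (quasidet A (insert j J) K j t' * v t') := by rw [← b2, a2]; exact hu
  generalize quasidet A (insert i J) K i t' = y
  obtain ⟨d, hd'⟩ := hu'
  rw [← hd'] at hu2 ⊢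
  obtain ⟨w, hw⟩ := hu2
  have hvs : v t' = ((d⁻¹ * w : Rˣ) : R) := by rw [Units.val_mul, hw]; simp
  rw [hvs, ← Units.val_mul, Ring.inverse_unit, Ring.inverse_unit, mul_assoc, ← Units.val_mul]
  simp

/-- A pair of `n × n` matrices `L⁺`, `L⁻` over `R`. The index `k : Fin n` stands for `k + 1`. -/
@[ext]
structure LPair (n : ℕ) (R : Type*) where
  plus : Matrix (Fin n) (Fin n) R
  minus : Matrix (Fin n) (Fin n) R

/-- `L⁺` is upper triangular with diagonal `u_1, …, u_n`, and `L⁻` is lower triangular with diagonal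
`u_0, …, u_{n-1}`, where `u_0 = 1` and all `u_k` are invertible. -/
def LPair.IsLOperator {n : ℕ} {R : Type*} [Ring R] (L : LPair n R) : Prop :=
  (∀ i j, j < i → L.plus i j = 0) ∧ (∀ i j, i < j → L.minus i j = 0) ∧
  ∃ u : ℕ → R, u 0 = 1 ∧ (∀ k, IsUnit (u k)) ∧
    ∀ i : Fin n, L.plus i i = u (i + 1) ∧ L.minus i i = u i

/-- The zero-curvature relation between `X = (L^(1), L^(2))` and `Y = (L̃^(1), L̃^(2))`. -/
def ZeroCurvature {n : ℕ} {R : Type*} [Ring R] (X Y : LPair n R × LPair n R) : Prop :=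
  X.1.plus * X.2.plus = Y.2.plus * Y.1.plus ∧
  X.1.minus * X.2.plus = Y.2.plus * Y.1.minus ∧
  X.1.minus * X.2.minus = Y.2.minus * Y.1.minus

/-- The block matrix `M`; `Sum.inl k` is the barred index `k̄`, `Sum.inr k` the plain index `k`. -/
def matM {n : ℕ} {R : Type*} [Ring R] (X : LPair n R × LPair n R) :
    Matrix (Fin n ⊕ Fin n) (Fin n ⊕ Fin n) R :=
  Matrix.fromBlocks 0 (X.1.minus * X.2.minus) (X.1.plus * X.2.plus) (X.1.minus * X.2.plus)

/-- The block matrix `M̃`; `Sum.inl k` is the barred index `k̄`, `Sum.inr k` the plain index `k`. -/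
def matMt {n : ℕ} {R : Type*} [Ring R] (Y : LPair n R × LPair n R) :
    Matrix (Fin n ⊕ Fin n) (Fin n ⊕ Fin n) R :=
  Matrix.fromBlocks 0 (Y.2.plus * Y.1.plus) (Y.2.minus * Y.1.minus) (Y.2.plus * Y.1.minus)

/-- A set of plain (unbarred) indices of the block matrices. -/
def plain {n : ℕ} (S : Finset (Fin n)) : Finset (Fin n ⊕ Fin n) :=
  S.map Function.Embedding.inr

/-- The ordered product `f 0 * f 1 * ⋯ * f (i - 1)`. -/
def prodRight {n : ℕ} {R : Type*} [Ring R] (f : Fin n → R) (i : Fin n) : R :=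
  (List.ofFn fun k : Fin i => f (Fin.castLE i.isLt.le k)).prod

/-- The ordered product `f (i - 1) * ⋯ * f 1 * f 0`. -/
def prodLeft {n : ℕ} {R : Type*} [Ring R] (f : Fin n → R) (i : Fin n) : R :=
  (List.ofFn fun k : Fin i => f (Fin.castLE i.isLt.le k)).reverse.prod

section Maps

open Sum

/-- `q^{k+1,…,n}_{a b}` of the rows `k, …, n` of `M`. -/
noncomputable def qM {n : ℕ} {R : Type*} [Ring R] (X : LPair n R × LPair n R) (k : Fin n)
    (a b : Fin n ⊕ Fin n) : R :=
  leftQP (matM X) (plain (Finset.Ici k)) (plain (Finset.Ioi k)) a b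

/-- `r^{k+1,…,n}_{a b}` of the columns `k, …, n` of `M`. -/
noncomputable def rM {n : ℕ} {R : Type*} [Ring R] (X : LPair n R × LPair n R) (k : Fin n)
    (a b : Fin n ⊕ Fin n) : R :=
  rightQP (matM X) (plain (Finset.Ici k)) (plain (Finset.Ioi k)) a b

/-- `q^{1,…,k-1}_{a b}` of the rows `1, …, k` of `M̃`. -/
noncomputable def qMt {n : ℕ} {R : Type*} [Ring R] (Y : LPair n R × LPair n R) (k : Fin n)
    (a b : Fin n ⊕ Fin n) : R :=
  leftQP (matMt Y) (plain (Finset.Iic k)) (plain (Finset.Iio k)) a b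

/-- `r^{1,…,k-1}_{a b}` of the columns `1, …, k` of `M̃`. -/
noncomputable def rMt {n : ℕ} {R : Type*} [Ring R] (Y : LPair n R × LPair n R) (k : Fin n)
    (a b : Fin n ⊕ Fin n) : R :=
  rightQP (matMt Y) (plain (Finset.Iic k)) (plain (Finset.Iio k)) a b

/-- The map `(L^(1), L^(2)) ↦ (L̃^(1), L̃^(2))` in terms of quasi-Plücker coordinates of `M`. -/
noncomputable def forwardMap {n : ℕ} {R : Type*} [Ring R] (X : LPair n R × LPair n R) :
    LPair n R × LPair n R :=
  ({ plus := Matrix.of fun i j => if i ≤ j then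
        prodRight (fun k => qM X k (inr k) (inl k)) i * qM X i (inr i) (inl j) else 0
     minus := Matrix.of fun j i => if i ≤ j then
        prodRight (fun k => qM X k (inr k) (inl k)) j * qM X j (inr j) (inr i) else 0 },
   { plus := Matrix.of fun i j => if i ≤ j then
        rM X j (inr i) (inl j) * prodLeft (fun k => rM X k (inr k) (inl k)) j else 0
     minus := Matrix.of fun j i => if i ≤ j then
        rM X i (inl j) (inl i) * prodLeft (fun k => rM X k (inr k) (inl k)) i else 0 })

/-- The map `(L̃^(1), L̃^(2)) ↦ (L^(1), L^(2))` in terms of quasi-Plücker coordinates of `M̃`. -/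
noncomputable def backwardMap {n : ℕ} {R : Type*} [Ring R] (Y : LPair n R × LPair n R) :
    LPair n R × LPair n R :=
  ({ plus := Matrix.of fun i j => if i ≤ j then
        rMt Y j (inl i) (inr j) * prodLeft (fun k => rMt Y k (inl k) (inr k)) j else 0
     minus := Matrix.of fun j i => if i ≤ j then
        rMt Y i (inr j) (inr i) * prodLeft (fun k => rMt Y k (inl k) (inr k)) i else 0 },
   { plus := Matrix.of fun i j => if i ≤ j then
        prodRight (fun k => qMt Y k (inl k) (inr k)) i * qMt Y i (inl i) (inr j) else 0
     minus := Matrix.of fun j i => if i ≤ j then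
        prodRight (fun k => qMt Y k (inl k) (inr k)) j * qMt Y j (inl j) (inl i) else 0 })

/-- All quasi-Plücker coordinates in the formulas of `forwardMap X` are well defined. -/
def ForwardDefined {n : ℕ} {R : Type*} [Ring R] (X : LPair n R × LPair n R) : Prop :=
  let q := fun (k : Fin n) (a b : Fin n ⊕ Fin n) =>
    LeftQPDefined (matM X) (plain (Finset.Ici k)) (plain (Finset.Ioi k)) a b
  let r := fun (k : Fin n) (a b : Fin n ⊕ Fin n) =>
    RightQPDefined (matM X) (plain (Finset.Ici k)) (plain (Finset.Ioi k)) a b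
  (∀ k, q k (inr k) (inl k) ∧ r k (inr k) (inl k)) ∧
  ∀ i j, i ≤ j → q i (inr i) (inl j) ∧ q j (inr j) (inr i) ∧
    r j (inr i) (inl j) ∧ r i (inl j) (inl i)

/-- All quasi-Plücker coordinates in the formulas of `backwardMap Y` are well defined. -/
def BackwardDefined {n : ℕ} {R : Type*} [Ring R] (Y : LPair n R × LPair n R) : Prop :=
  let q := fun (k : Fin n) (a b : Fin n ⊕ Fin n) =>
    LeftQPDefined (matMt Y) (plain (Finset.Iic k)) (plain (Finset.Iio k)) a b
  let r := fun (k : Fin n) (a b : Fin n ⊕ Fin n) =>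
    RightQPDefined (matMt Y) (plain (Finset.Iic k)) (plain (Finset.Iio k)) a b
  (∀ k, q k (inl k) (inr k) ∧ r k (inl k) (inr k)) ∧
  ∀ i j, i ≤ j → r j (inl i) (inr j) ∧ r i (inr j) (inr i) ∧
    q i (inl i) (inr j) ∧ q j (inl j) (inl i)

end Maps

/-- The domain of the forward map: `L^(1)`, `L^(2)` have the prescribed shape, and with
`J = L^{-(1)} L^{+(2)}` the quasi-determinants `|J^{k,…,n}_{k,…,n}|_{kk}` are well defined and
invertible. -/
def ForwardDomain {n : ℕ} {R : Type*} [Ring R] (X : LPair n R × LPair n R) : Prop :=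
  X.1.IsLOperator ∧ X.2.IsLOperator ∧ ∀ k : Fin n,
    QuasidetDefined (X.1.minus * X.2.plus) (Finset.Ici k) (Finset.Ici k) k k ∧
    IsUnit (quasidet (X.1.minus * X.2.plus) (Finset.Ici k) (Finset.Ici k) k k)

/-- The domain of the backward map: `L̃^(1)`, `L̃^(2)` have the prescribed shape, and with
`J̃ = L̃^{+(2)} L̃^{-(1)}` the quasi-determinants `|J̃^{1,…,k}_{1,…,k}|_{kk}` are well defined and
invertible. -/
def BackwardDomain {n : ℕ} {R : Type*} [Ring R] (Y : LPair n R × LPair n R) : Prop :=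
  Y.1.IsLOperator ∧ Y.2.IsLOperator ∧ ∀ k : Fin n,
    QuasidetDefined (Y.2.plus * Y.1.minus) (Finset.Iic k) (Finset.Iic k) k k ∧
    IsUnit (quasidet (Y.2.plus * Y.1.minus) (Finset.Iic k) (Finset.Iic k) k k)

/-!
The zero-curvature relation factors the plain rows of `M` as `L̃^{+(2)} (L̃^{+(1)} | L̃^{-(1)})`.
Left quasi-Plücker coordinates do not change under left multiplication by an invertible triangular
matrix, and those of the second factor are the ratios of the entries of a row to one diagonal entry,
because `L̃^{-(1)}` is triangular. The ordered products in the formulas then telescope and return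
`L̃^{±(1)}`. The columns of `M` and the matrix `M̃` are treated in the same way, so any two pairs of
L-operators related by zero curvature are images of each other.

Such a partner exists on each domain: invertibility of the quasi-determinants of `J` gives a Gauss
factorization `J = L̃^{+(2)} L̃^{-(1)}`, whose diagonals can be prescribed so that they fit the
required sequences, and the first and third relations then define the remaining matrices. For `J̃`
the order of the indices is reversed.
-/
section Triangular

open Matrix

variable {R m α : Type*} [Ring R] [Fintype m] [LinearOrder α] {b : m ↪ α}

theorem blockTriangular_mul_apply_self {A B : Matrix m m R} (hA : A.BlockTriangular b)
    (hB : B.BlockTriangular b) (i : m) : (A * B) i i = A i i * B i i := by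
  rw [Matrix.mul_apply]
  refine Finset.sum_eq_single i (fun k _ hk => ?_) (fun h => absurd (Finset.mem_univ i) h)
  rcases lt_or_gt_of_ne (b.injective.ne hk) with h | h
  · rw [hA h, zero_mul]
  · rw [hB h, mul_zero]

/-- The indices strictly above `k`, for the order on indices induced by `b`. -/
def above (b : m ↪ α) (k : m) : Finset m :=
  {l | b k < b l}

@[simp]
theorem mem_above {k l : m} : l ∈ above b k ↔ b k < b l := by
  simp [above]

theorem above_ssubset_above {k l : m} (h : b k < b l) : above b l ⊂ above b k := by
  refine Finset.ssubset_iff_of_subset (fun i hi => ?_) |>.2 ⟨l, mem_above.2 h, by simp⟩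
  exact mem_above.2 (h.trans (mem_above.1 hi))

variable [DecidableEq m]

theorem isNilpotent_of_blockTriangular {A : Matrix m m R} (hA : A.BlockTriangular b)
    (hdiag : ∀ i, A i i = 0) : IsNilpotent A := by
  have pow_eq_zero : ∀ p i, (above b i).card < p → ∀ j, (A ^ p) i j = 0 := by
    intro p
    induction p with
    | zero => exact fun i h => absurd h (Nat.not_lt_zero _)
    | succ p ih =>
      intro i hi j
      rw [pow_succ', Matrix.mul_apply]
      refine Finset.sum_eq_zero fun k _ => ?_
      rcases lt_trichotomy (b k) (b i) with h | h | h
      · rw [hA h, zero_mul]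
      · rw [b.injective h, hdiag, zero_mul]
      · rw [ih k ((Finset.card_lt_card (above_ssubset_above h)).trans_le (Nat.lt_succ_iff.1 hi)),
          mul_zero]
  exact ⟨Fintype.card m + 1, Matrix.ext fun i =>
    pow_eq_zero _ i (Nat.lt_succ_iff.2 (Finset.card_le_univ _))⟩

/-- The group of invertible matrices `A` such that both `A` and `A⁻¹` are upper triangular for the
order on indices induced by `b`. Lower triangular matrices are obtained from the dual order. -/
abbrev TriangularUnits (R : Type*) [Ring R] (b : m ↪ α) : Type _ :=
  (blockTriangularSubalgebra ℤ R b)ˣ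

namespace TriangularUnits

theorem blockTriangular (V : TriangularUnits R b) : (V : Matrix m m R).BlockTriangular b :=
  V.val.2

@[simp]
theorem mul_inv_coe (V : TriangularUnits R b) :
    (V : Matrix m m R) * (V⁻¹ : TriangularUnits R b) = 1 :=
  congrArg Subtype.val V.mul_inv

@[simp]
theorem inv_mul_coe (V : TriangularUnits R b) :
    ((V⁻¹ : TriangularUnits R b) : Matrix m m R) * V = 1 :=
  congrArg Subtype.val V.inv_mul

/-- The diagonal of a triangular matrix, as a homomorphism to the group of invertible diagonals. -/
def diag : TriangularUnits R b →* (m → Rˣ) :=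
  MulEquiv.piUnits.toMonoidHom.comp <| Units.map
    { toFun A i := (A : Matrix m m R) i i
      map_one' := funext fun _ => Matrix.one_apply_eq _
      map_mul' A B := funext fun i => blockTriangular_mul_apply_self A.2 B.2 i }

@[simp]
theorem coe_diag (V : TriangularUnits R b) (i : m) : (diag V i : R) = (V : Matrix m m R) i i :=
  rfl

/-- The invertible diagonal matrix with diagonal `u`. -/
def diagonal (b : m ↪ α) (u : m → Rˣ) : TriangularUnits R b where
  val := ⟨Matrix.diagonal fun i => (u i : R), blockTriangular_diagonal _⟩
  inv := ⟨Matrix.diagonal fun i => ((u i)⁻¹ : Rˣ), blockTriangular_diagonal _⟩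
  val_inv := Subtype.ext <| by simp [Matrix.diagonal_mul_diagonal]
  inv_val := Subtype.ext <| by simp [Matrix.diagonal_mul_diagonal]

theorem exists_coe_eq {A : Matrix m m R} (hA : A.BlockTriangular b) {u : m → Rˣ}
    (hu : ∀ i, A i i = u i) : ∃ V : TriangularUnits R b, (V : Matrix m m R) = A ∧ diag V = u := by
  let A' : blockTriangularSubalgebra ℤ R b := ⟨A, hA⟩
  let N := 1 - ((diagonal b u)⁻¹ : TriangularUnits R b) * A'
  have hN : IsNilpotent N := by
    obtain ⟨p, hp⟩ := isNilpotent_of_blockTriangular N.2 fun i => by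
      simp [N, A', diagonal, Units.inv_mk, hu]
    exact ⟨p, Subtype.ext hp⟩
  obtain ⟨W, hW⟩ := hN.isUnit_one_sub
  have hV : ((diagonal b u * W : TriangularUnits R b) : Matrix m m R) = A := by
    rw [Units.val_mul, hW, sub_sub_cancel, Units.mul_inv_cancel_left]
  exact ⟨diagonal b u * W, hV, funext fun i => Units.ext <| by rw [coe_diag, hV, hu]⟩

end TriangularUnits

end Triangular

section Quasidet

variable {R ι κ : Type*} [Ring R] [DecidableEq ι] [DecidableEq κ]

/-- The quasi-determinant `|A^I_K|_{ij}` is well defined and equal to `x`. -/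
def HasQuasidet (A : Matrix ι κ R) (I : Finset ι) (K : Finset κ) (i : ι) (j : κ) (x : R) : Prop :=
  QuasidetDefined A I K i j ∧ quasidet A I K i j = x

/-- The left quasi-Plücker coordinate `q^J_{ij}(A^I)` is well defined and equal to `x`. -/
def HasLeftQP (A : Matrix ι κ R) (I : Finset ι) (J : Finset κ) (i j : κ) (x : R) : Prop :=
  LeftQPDefined A I J i j ∧ leftQP A I J i j = x

/-- The right quasi-Plücker coordinate `r^J_{ij}(A_K)` is well defined and equal to `x`. -/
def HasRightQP (A : Matrix ι κ R) (K : Finset κ) (J : Finset ι) (i j : ι) (x : R) : Prop :=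
  RightQPDefined A K J i j ∧ rightQP A K J i j = x

theorem HasQuasidet.hasLeftQP {A : Matrix ι κ R} {I : Finset ι} {J : Finset κ} {i j : κ} {s : ι}
    {u x : Rˣ} {y : R} (hi : i ∉ J) (hx : HasQuasidet A I (insert i J) s i (u * x))
    (hy : HasQuasidet A I (insert j J) s j (u * y)) : HasLeftQP A I J i j (↑x⁻¹ * y) := by
  have h : LeftQPAdmissible A I J i j s := ⟨hi, hx.1, hy.1, hx.2 ▸ u.isUnit.mul x.isUnit⟩
  refine ⟨⟨s, h⟩, ?_⟩
  rw [leftQP_eq h, hx.2, hy.2, ← Units.val_mul, Ring.inverse_unit, mul_inv_rev, Units.val_mul,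
    mul_assoc, Units.inv_mul_cancel_left]

theorem HasQuasidet.hasRightQP {A : Matrix ι κ R} {K : Finset κ} {J : Finset ι} {i j : ι} {t : κ}
    {u x : Rˣ} {y : R} (hj : j ∉ J) (hy : HasQuasidet A (insert i J) K i t (y * u))
    (hx : HasQuasidet A (insert j J) K j t (x * u)) : HasRightQP A K J i j (y * ↑x⁻¹) := by
  have h : RightQPAdmissible A K J i j t := ⟨hj, hy.1, hx.1, hx.2 ▸ x.isUnit.mul u.isUnit⟩
  refine ⟨⟨t, h⟩, ?_⟩
  rw [rightQP_eq h, hx.2, hy.2, ← Units.val_mul, Ring.inverse_unit, mul_inv_rev, Units.val_mul,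
    mul_assoc, Units.mul_inv_cancel_left]

end Quasidet

section BlockInverse

theorem exists_isBlockInv_map {R m ι κ : Type*} [Ring R] {A : Matrix ι κ R} {f : m ↪ ι} {g : m ↪ κ}
    {S : Finset m} (h : ∃ X, IsBlockInv (A.submatrix f g) S S X) :
    ∃ X, IsBlockInv A (S.map f) (S.map g) X := by
  classical
  obtain ⟨X, hX₁, hX₂⟩ := h
  refine ⟨Function.extend g (fun k => Function.extend f (X k) 0) 0, ?_, ?_⟩
  · simpa only [Finset.forall_mem_map, Finset.sum_map, f.apply_eq_iff_eq,
      f.injective.extend_apply, g.injective.extend_apply, Matrix.submatrix_apply] using hX₁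
  · simpa only [Finset.forall_mem_map, Finset.sum_map, g.apply_eq_iff_eq,
      f.injective.extend_apply, g.injective.extend_apply, Matrix.submatrix_apply] using hX₂

variable {R m α β : Type*} [Ring R] [Fintype m] [DecidableEq m] [LinearOrder α] [LinearOrder β]
  {b : m ↪ α} {c : m ↪ β}

/-- The projection of `m → R` to the coordinates in `S`. -/
def coordProj (R : Type*) [Ring R] (S : Finset m) : Matrix m m R :=
  Matrix.diagonal fun i => if i ∈ S then 1 else 0

theorem sum_mul_eq_mul_coordProj_mul (S : Finset m) (A B : Matrix m m R) (i j : m) :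
    ∑ k ∈ S, A i k * B k j = (A * coordProj R S * B) i j := by
  simp [Matrix.mul_apply (M := A * _), coordProj, Matrix.mul_diagonal, Finset.sum_ite_mem]

theorem coordProj_mul_apply {S : Finset m} {i : m} (hi : i ∈ S) (A : Matrix m m R) (j : m) :
    (coordProj R S * A) i j = A i j := by
  simp [coordProj, Matrix.diagonal_mul, hi]

theorem mul_coordProj_apply {S : Finset m} {j : m} (hj : j ∈ S) (A : Matrix m m R) (i : m) :
    (A * coordProj R S) i j = A i j := by
  simp [coordProj, Matrix.mul_diagonal, hj]

theorem coordProj_mul_mul_coordProj {S : Finset m} {A : Matrix m m R}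
    (hA : ∀ i ∈ S, ∀ j ∉ S, A i j = 0) :
    coordProj R S * A * coordProj R S = coordProj R S * A := by
  ext i j
  simp only [coordProj, Matrix.diagonal_mul, Matrix.mul_diagonal]
  grind

theorem coordProj_mul_mul_coordProj' {S : Finset m} {A : Matrix m m R}
    (hA : ∀ i ∉ S, ∀ j ∈ S, A i j = 0) :
    coordProj R S * A * coordProj R S = A * coordProj R S := by
  ext i j
  simp only [coordProj, Matrix.diagonal_mul, Matrix.mul_diagonal]
  grind

/-- For the projection `e` to the coordinates in `S`, triangularity reads `e * V * e = e * V` and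
`e * D * e = D * e`, so that `D⁻¹ * e * V⁻¹` restricts to an inverse of `V * D` on `S`. -/
theorem exists_isBlockInv_mul (hbc : ∀ i j, c i < c j ↔ b j < b i) (V : TriangularUnits R b)
    (D : TriangularUnits R c) {S : Finset m} (hS : ∀ i ∈ S, ∀ j ∉ S, b j < b i) :
    ∃ X, IsBlockInv ((V : Matrix m m R) * (D : Matrix m m R)) S S X := by
  let e := coordProj R S
  have hV (W : TriangularUnits R b) : e * W * e = e * W :=
    coordProj_mul_mul_coordProj fun i hi j hj => W.blockTriangular (hS i hi j hj)
  have hD (W : TriangularUnits R c) : e * W * e = W * e :=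
    coordProj_mul_mul_coordProj' fun i hi j hj =>
      W.blockTriangular ((hbc j i).2 (hS j hj i hi))
  let X : Matrix m m R := (D⁻¹ : TriangularUnits R c) * e * (V⁻¹ : TriangularUnits R b)
  have mul_X : e * ((V * D : Matrix m m R) * e * X) = e := by
    calc e * ((V * D : Matrix m m R) * e * X)
      _ = e * V * (D * (e * (D⁻¹ : TriangularUnits R c) * e)) * (V⁻¹ : TriangularUnits R b) := by
        simp only [X, mul_assoc]
      _ = e * V * e * (V⁻¹ : TriangularUnits R b) := by
        rw [hD, ← mul_assoc (D : Matrix m m R), TriangularUnits.mul_inv_coe, one_mul]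
      _ = e := by rw [hV, mul_assoc, TriangularUnits.mul_inv_coe, mul_one]
  have X_mul : X * e * (V * D : Matrix m m R) * e = e := by
    calc X * e * (V * D : Matrix m m R) * e
      _ = (D⁻¹ : TriangularUnits R c) * (e * (V⁻¹ : TriangularUnits R b) * e * V) * D * e := by
        simp only [X, mul_assoc]
      _ = (D⁻¹ : TriangularUnits R c) * (e * D * e) := by
        rw [hV, mul_assoc e, TriangularUnits.inv_mul_coe, mul_one]; simp only [mul_assoc]
      _ = e := by rw [hD, ← mul_assoc, TriangularUnits.inv_mul_coe, one_mul]
  refine ⟨X, fun l hl l' _ => ?_, fun k _ k' hk' => ?_⟩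
  · rw [sum_mul_eq_mul_coordProj_mul]
    refine (coordProj_mul_apply hl _ _).symm.trans ((congrFun₂ mul_X l l').trans ?_)
    simp only [e, coordProj, Matrix.diagonal_apply]
    grind
  · rw [sum_mul_eq_mul_coordProj_mul]
    refine (mul_coordProj_apply hk' _ _).symm.trans ((congrFun₂ X_mul k k').trans ?_)
    simp only [e, coordProj, Matrix.diagonal_apply]
    grind

theorem exists_isBlockInv_map_above {ι κ : Type*} {A : Matrix ι κ R} {f : m ↪ ι}
    {g : m ↪ κ} (hbc : ∀ i j, c i < c j ↔ b j < b i) {V : TriangularUnits R b}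
    {D : TriangularUnits R c} (hA : A.submatrix f g = (V : Matrix m m R) * (D : Matrix m m R))
    (k : m) : ∃ X, IsBlockInv A ((above b k).map f) ((above b k).map g) X := by
  refine exists_isBlockInv_map (hA ▸ exists_isBlockInv_mul hbc V D fun i hi j hj => ?_)
  rw [mem_above] at hi hj
  exact (not_lt.1 hj).trans_lt hi

end BlockInverse

section Factorization

variable {R m ι κ α β : Type*} [Ring R] [Fintype m] [DecidableEq m] [DecidableEq ι] [DecidableEq κ]
  [LinearOrder α] [LinearOrder β] {b : m ↪ α} {c : m ↪ β} {A : Matrix ι κ R} {f : m ↪ ι} {g : m ↪ κ}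

theorem sum_insert_above {M : Type*} [AddCommMonoid M] {k : m} {φ : m → M}
    (hφ : ∀ l, b l < b k → φ l = 0) : ∑ l ∈ insert k (above b k), φ l = ∑ l, φ l := by
  refine Finset.sum_subset (Finset.subset_univ _) fun l _ hl => hφ l ?_
  rw [Finset.mem_insert, mem_above, not_or, not_lt] at hl
  exact hl.2.lt_of_ne (b.injective.ne hl.1)

theorem quasidetDefined_map_left (hbc : ∀ i j, c i < c j ↔ b j < b i) {V : TriangularUnits R b}
    {D : TriangularUnits R c} (hA : A.submatrix f g = (V : Matrix m m R) * (D : Matrix m m R))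
    (k : m) {a : κ} (ha : a ∉ (above b k).map g) :
    QuasidetDefined A ((insert k (above b k)).map f) (insert a ((above b k).map g)) (f k) a := by
  have hk : k ∉ above b k := by simp
  refine ⟨by simp, Finset.mem_insert_self _ _, ?_, ?_⟩
  · rw [Finset.card_insert_of_notMem ha, Finset.card_map, Finset.card_map,
      Finset.card_insert_of_notMem hk]
  · rw [← Finset.map_erase, Finset.erase_insert hk, Finset.erase_insert ha]
    exact exists_isBlockInv_map_above hbc hA k

theorem quasidetDefined_map_right (hbc : ∀ i j, c i < c j ↔ b j < b i) {V : TriangularUnits R b}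
    {D : TriangularUnits R c} (hA : A.submatrix f g = (V : Matrix m m R) * (D : Matrix m m R))
    (k : m) {a : ι} (ha : a ∉ (above b k).map f) :
    QuasidetDefined A (insert a ((above b k).map f)) ((insert k (above b k)).map g) a (g k) := by
  have hk : k ∉ above b k := by simp
  refine ⟨Finset.mem_insert_self _ _, by simp, ?_, ?_⟩
  · rw [Finset.card_insert_of_notMem ha, Finset.card_map, Finset.card_map,
      Finset.card_insert_of_notMem hk]
  · rw [← Finset.map_erase, Finset.erase_insert hk, Finset.erase_insert ha]
    exact exists_isBlockInv_map_above hbc hA k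

/-- Row `k` of `V⁻¹` combines the rows `f l` of `A` to row `k` of `B`, which vanishes in the columns
`g l` with `l` above `k`. -/
theorem hasQuasidet_of_left_factor (hbc : ∀ i j, c i < c j ↔ b j < b i) {V : TriangularUnits R b}
    {D : TriangularUnits R c} {B : Matrix m κ R} (hA : A.submatrix f id = (V : Matrix m m R) * B)
    (hB : B.submatrix id g = (D : Matrix m m R)) (k : m) {a : κ} (ha : a ∉ (above b k).map g) :
    HasQuasidet A ((insert k (above b k)).map f) (insert a ((above b k).map g)) (f k) a
      (TriangularUnits.diag V k * B k a) := by
  have hAg : A.submatrix f g = (V : Matrix m m R) * (D : Matrix m m R) :=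
    hB ▸ congrArg (Matrix.submatrix · id g) hA
  have hdef := quasidetDefined_map_left hbc hAg k ha
  let v : ι → R := Function.extend f (((V⁻¹ : TriangularUnits R b) : Matrix m m R) k) 0
  have combine_rows (x : κ) : ∑ l ∈ (insert k (above b k)).map f, v l * A l x = B k x := by
    calc ∑ l ∈ (insert k (above b k)).map f, v l * A l x
      _ = ∑ l, ((V⁻¹ : TriangularUnits R b) : Matrix m m R) k l * A (f l) x := by
        simp only [Finset.sum_map, v, f.injective.extend_apply]
        exact sum_insert_above fun l hl => by rw [V⁻¹.blockTriangular hl, zero_mul]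
      _ = (((V⁻¹ : TriangularUnits R b) : Matrix m m R) * A.submatrix f id) k x := rfl
      _ = B k x := by
        rw [hA, ← Matrix.mul_assoc, TriangularUnits.inv_mul_coe, Matrix.one_mul]
  have combine_rows_eq_zero : ∀ y ∈ (above b k).map g,
      ∑ l ∈ (insert k (above b k)).map f, v l * A l y = 0 := by
    refine Finset.forall_mem_map.2 fun l hl => (combine_rows _).trans ?_
    exact (congrFun₂ hB k l).trans (D.blockTriangular ((hbc l k).2 (mem_above.1 hl)))
  have hv : v (f k) = ↑(TriangularUnits.diag V k)⁻¹ := by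
    rw [← Pi.inv_apply, ← map_inv]
    simp only [v, f.injective.extend_apply, TriangularUnits.coe_diag]
  refine ⟨hdef, ?_⟩
  rw [← combine_rows a, left_aux A _ _ a (f k) ha hdef.1 (Finset.erase_insert ha ▸ hdef.2.2.2) v
    combine_rows_eq_zero, hv, Units.mul_inv_cancel_left]

/-- Column `k` of `D⁻¹` combines the columns `g l` of `A` to column `k` of `B`, which vanishes in
the rows `f l` with `l` above `k`. -/
theorem hasQuasidet_of_right_factor (hbc : ∀ i j, c i < c j ↔ b j < b i) {V : TriangularUnits R b}
    {D : TriangularUnits R c} {B : Matrix ι m R} (hA : A.submatrix id g = B * (D : Matrix m m R))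
    (hB : B.submatrix f id = (V : Matrix m m R)) (k : m) {a : ι} (ha : a ∉ (above b k).map f) :
    HasQuasidet A (insert a ((above b k).map f)) ((insert k (above b k)).map g) a (g k)
      (B a k * TriangularUnits.diag D k) := by
  have hAf : A.submatrix f g = (V : Matrix m m R) * (D : Matrix m m R) :=
    hB ▸ congrArg (Matrix.submatrix · f id) hA
  have hdef := quasidetDefined_map_right hbc hAf k ha
  let v : κ → R :=
    Function.extend g (fun l => ((D⁻¹ : TriangularUnits R c) : Matrix m m R) l k) 0
  have combine_cols (x : ι) : ∑ l ∈ (insert k (above b k)).map g, A x l * v l = B x k := by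
    calc ∑ l ∈ (insert k (above b k)).map g, A x l * v l
      _ = ∑ l, A x (g l) * ((D⁻¹ : TriangularUnits R c) : Matrix m m R) l k := by
        simp only [Finset.sum_map, v, g.injective.extend_apply]
        exact sum_insert_above fun l hl => by
          rw [D⁻¹.blockTriangular ((hbc k l).2 hl), mul_zero]
      _ = (A.submatrix id g * ((D⁻¹ : TriangularUnits R c) : Matrix m m R)) x k := rfl
      _ = B x k := by
        rw [hA, Matrix.mul_assoc, TriangularUnits.mul_inv_coe, Matrix.mul_one]
  have combine_cols_eq_zero : ∀ y ∈ (above b k).map f,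
      ∑ l ∈ (insert k (above b k)).map g, A y l * v l = 0 := by
    refine Finset.forall_mem_map.2 fun l hl => (combine_cols _).trans ?_
    exact (congrFun₂ hB l k).trans (V.blockTriangular (mem_above.1 hl))
  have hv : v (g k) = ↑(TriangularUnits.diag D k)⁻¹ := by
    rw [← Pi.inv_apply, ← map_inv]
    simp only [v, g.injective.extend_apply, TriangularUnits.coe_diag]
  refine ⟨hdef, ?_⟩
  rw [← combine_cols a, right_aux A _ _ a (g k) ha hdef.2.1 (Finset.erase_insert ha ▸ hdef.2.2.2) v
    combine_cols_eq_zero, hv, Units.inv_mul_cancel_right]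

theorem hasQuasidet_mul_self (hbc : ∀ i j, c i < c j ↔ b j < b i) (V : TriangularUnits R b)
    (D : TriangularUnits R c) (k : m) :
    HasQuasidet ((V : Matrix m m R) * (D : Matrix m m R)) (insert k (above b k))
      (insert k (above b k)) k k ↑(TriangularUnits.diag V k * TriangularUnits.diag D k) := by
  have h := hasQuasidet_of_left_factor (f := .refl m) (g := .refl m) (a := k) hbc
    (A := (V : Matrix m m R) * (D : Matrix m m R)) rfl rfl k (by simp)
  rw [Finset.map_refl, Finset.map_refl] at h
  exact h

theorem hasLeftQP_of_left_factor (hbc : ∀ i j, c i < c j ↔ b j < b i) {V : TriangularUnits R b}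
    {D : TriangularUnits R c} {B : Matrix m κ R} (hA : A.submatrix f id = (V : Matrix m m R) * B)
    (hB : B.submatrix id g = (D : Matrix m m R)) {k : m} {i j : κ} {x : Rˣ} (hx : B k i = x)
    (hi : i ∉ (above b k).map g) (hj : j ∉ (above b k).map g) :
    HasLeftQP A ((insert k (above b k)).map f) ((above b k).map g) i j (↑x⁻¹ * B k j) :=
  (hx ▸ hasQuasidet_of_left_factor hbc hA hB k hi).hasLeftQP hi
    (hasQuasidet_of_left_factor hbc hA hB k hj)

theorem hasRightQP_of_right_factor (hbc : ∀ i j, c i < c j ↔ b j < b i) {V : TriangularUnits R b}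
    {D : TriangularUnits R c} {B : Matrix ι m R} (hA : A.submatrix id g = B * (D : Matrix m m R))
    (hB : B.submatrix f id = (V : Matrix m m R)) {k : m} {i j : ι} {x : Rˣ} (hx : B j k = x)
    (hi : i ∉ (above b k).map f) (hj : j ∉ (above b k).map f) :
    HasRightQP A ((insert k (above b k)).map g) ((above b k).map f) i j (B i k * ↑x⁻¹) :=
  (hasQuasidet_of_right_factor hbc hA hB k hi).hasRightQP hj
    (hx ▸ hasQuasidet_of_right_factor hbc hA hB k hj)

end Factorization

section GaussDecomposition

open scoped Matrix

variable {R m α β : Type*} [Ring R] [Fintype m] [DecidableEq m] [LinearOrder α] [LinearOrder β]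
  {b : m ↪ α} {c : m ↪ β}

theorem HasQuasidet.exists_row {J : Matrix m m R} {k : m} {x : R}
    (h : HasQuasidet J (insert k (above b k)) (insert k (above b k)) k k x) :
    ∃ v : m → R, v k = 1 ∧ (∀ l, b l < b k → v l = 0) ∧ (v ᵥ* J) k = x ∧
      ∀ l, b k < b l → (v ᵥ* J) l = 0 := by
  have hk : k ∉ above b k := by simp
  have hinv : ∃ X, IsBlockInv J ((insert k (above b k)).erase k) (above b k) X := by
    simpa only [Finset.erase_insert hk] using h.1.2.2.2
  obtain ⟨v, hvk, hv⟩ := exists_left_row J _ _ k h.1.1 hinv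
  have hsum (l : m) : ((fun i => if b i < b k then 0 else v i) ᵥ* J) l =
      ∑ i ∈ insert k (above b k), v i * J i l := by
    rw [Matrix.vecMul, dotProduct,
      ← sum_insert_above (k := k) fun i hi => by rw [if_pos hi, zero_mul]]
    refine Finset.sum_congr rfl fun i hi => ?_
    rw [if_neg (by grind [mem_above])]
  refine ⟨fun i => if b i < b k then 0 else v i, by simpa using hvk, fun l hl => if_pos hl, ?_, ?_⟩
  · rw [hsum, left_aux J _ _ k k hk h.1.1 hinv v hv, hvk, one_mul, h.2]
  · exact fun l hl => (hsum l).trans (hv l (mem_above.2 hl))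

/-- Row `k` of `V⁻¹` is the vector of `HasQuasidet.exists_row`, scaled to have the entry `(e k)⁻¹`
on the diagonal. -/
theorem exists_gaussDecomposition (hbc : ∀ i j, c i < c j ↔ b j < b i) {J : Matrix m m R}
    {d : m → Rˣ} (hJ : ∀ k, HasQuasidet J (insert k (above b k)) (insert k (above b k)) k k (d k))
    (e : m → Rˣ) : ∃ (V : TriangularUnits R b) (D : TriangularUnits R c),
      (V : Matrix m m R) * (D : Matrix m m R) = J ∧ TriangularUnits.diag V = e ∧
        TriangularUnits.diag D = e⁻¹ * d := by
  choose v hv_self hv_lt hvJ_self hvJ_gt using fun k => (hJ k).exists_row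
  let W : Matrix m m R := Matrix.of fun k => (((e k)⁻¹ : Rˣ) : R) • v k
  have hWJ (k : m) : (W * J) k = (((e k)⁻¹ : Rˣ) : R) • (v k ᵥ* J) :=
    (Matrix.mul_apply_eq_vecMul W J k).trans (Matrix.smul_vecMul (((e k)⁻¹ : Rˣ) : R) (v k) J)
  obtain ⟨U, hU, hUdiag⟩ := TriangularUnits.exists_coe_eq (A := W) (b := b) (u := e⁻¹)
    (fun k l hl => by simp [W, hv_lt k l hl]) (fun k => by simp [W, hv_self])
  obtain ⟨D, hD, hDdiag⟩ := TriangularUnits.exists_coe_eq (A := W * J) (b := c) (u := e⁻¹ * d)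
    (fun k l hl => by simp [hWJ, hvJ_gt k l ((hbc l k).1 hl)]) (fun k => by simp [hWJ, hvJ_self])
  refine ⟨U⁻¹, D, ?_, ?_, hDdiag⟩
  · rw [hD, ← hU, ← Matrix.mul_assoc, TriangularUnits.inv_mul_coe, Matrix.one_mul]
  · rw [map_inv, hUdiag, inv_inv]

end GaussDecomposition

section Telescoping

variable {n : ℕ} {R : Type*} [Ring R] {u : ℕ → Rˣ} {f : Fin n → R}

theorem prodRight_eq (hu : u 0 = 1) (hf : ∀ k : Fin n, f k = ↑(u k)⁻¹ * u (k + 1)) (i : Fin n) :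
    prodRight f i = u i := by
  have telescope (p : ℕ) :
      (List.ofFn fun k : Fin p => (↑(u k)⁻¹ * u (k + 1) : R)).prod = u p := by
    induction p with
    | zero => simp [hu]
    | succ p ih =>
      rw [List.ofFn_succ', List.prod_concat]
      simp only [Fin.val_castSucc, Fin.val_last, ih, Units.mul_inv_cancel_left]
  simp only [prodRight, hf, Fin.val_castLE, telescope]

theorem prodLeft_eq (hu : u 0 = 1) (hf : ∀ k : Fin n, f k = u (k + 1) * ↑(u k)⁻¹) (i : Fin n) :
    prodLeft f i = u i := by
  have telescope (p : ℕ) :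
      (List.ofFn fun k : Fin p => (u (k + 1) * ↑(u k)⁻¹ : R)).reverse.prod = u p := by
    induction p with
    | zero => simp [hu]
    | succ p ih =>
      rw [List.ofFn_succ', List.concat_eq_append, List.reverse_concat, List.prod_cons]
      simp only [Fin.val_castSucc, Fin.val_last, ih, Units.inv_mul_cancel_right]
  simp only [prodLeft, hf, Fin.val_castLE, telescope]

variable {r : Fin n → Fin n → Prop} [DecidableRel r] {F P : Matrix (Fin n) (Fin n) R}

theorem of_ite_prodRight_mul (hu : u 0 = 1) (hf : ∀ k : Fin n, f k = ↑(u k)⁻¹ * u (k + 1))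
    (hF : ∀ i j, r i j → F i j = ↑(u i)⁻¹ * P i j) (hP : ∀ i j, ¬ r i j → P i j = 0) :
    (Matrix.of fun i j => if r i j then prodRight f i * F i j else 0) = P := by
  ext i j
  rw [Matrix.of_apply]
  split_ifs with hij
  · rw [prodRight_eq hu hf, hF i j hij, Units.mul_inv_cancel_left]
  · exact (hP i j hij).symm

theorem of_ite_mul_prodLeft (hu : u 0 = 1) (hf : ∀ k : Fin n, f k = u (k + 1) * ↑(u k)⁻¹)
    (hF : ∀ i j, r i j → F i j = P i j * ↑(u j)⁻¹) (hP : ∀ i j, ¬ r i j → P i j = 0) :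
    (Matrix.of fun i j => if r i j then F i j * prodLeft f j else 0) = P := by
  ext i j
  rw [Matrix.of_apply]
  split_ifs with hij
  · rw [prodLeft_eq hu hf, hF i j hij, Units.inv_mul_cancel_right]
  · exact (hP i j hij).symm

end Telescoping

section LOperators

variable {n : ℕ} {R : Type*} [Ring R]

/-- The order on indices for which the triangular matrices are the upper triangular ones. -/
abbrev increasing (n : ℕ) : Fin n ↪ Fin n :=
  Function.Embedding.refl (Fin n)

/-- The order on indices for which the triangular matrices are the lower triangular ones. -/
abbrev decreasing (n : ℕ) : Fin n ↪ (Fin n)ᵒᵈ :=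
  OrderDual.toDual.toEmbedding

/-- Invertible upper triangular matrices. -/
abbrev UpperUnits (n : ℕ) (R : Type*) [Ring R] : Type _ :=
  TriangularUnits R (increasing n)

/-- Invertible lower triangular matrices. -/
abbrev LowerUnits (n : ℕ) (R : Type*) [Ring R] : Type _ :=
  TriangularUnits R (decreasing n)

theorem above_increasing (k : Fin n) : above (increasing n) k = Finset.Ioi k := by
  ext l
  simp

theorem above_decreasing (k : Fin n) : above (decreasing n) k = Finset.Iio k := by
  ext l
  simp

/-- `U`, `C` are `L⁺`, `L⁻` as invertible triangular matrices, with diagonals given by `u`. -/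
structure LPair.HasUnits (L : LPair n R) (u : ℕ → Rˣ) (U : UpperUnits n R) (C : LowerUnits n R) :
    Prop where
  zero : u 0 = 1
  plus : U = L.plus
  minus : C = L.minus
  diag_plus : TriangularUnits.diag U = fun i : Fin n => u (i + 1)
  diag_minus : TriangularUnits.diag C = fun i : Fin n => u i

namespace LPair

variable {L : LPair n R} {u : ℕ → Rˣ} {U : UpperUnits n R} {C : LowerUnits n R}

theorem IsLOperator.exists_hasUnits (hL : L.IsLOperator) : ∃ u U C, L.HasUnits u U C := by
  obtain ⟨hplus, hminus, u, hu₀, hu, hdiag⟩ := hL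
  choose u' hu' using hu
  obtain ⟨U, hU, hUdiag⟩ := TriangularUnits.exists_coe_eq (b := increasing n)
    (u := fun i => u' (i + 1)) (fun i j hij => hplus i j hij) fun i => by rw [hu', (hdiag i).1]
  obtain ⟨C, hC, hCdiag⟩ := TriangularUnits.exists_coe_eq (b := decreasing n)
    (u := fun i => u' i) (fun i j hij => hminus i j hij) fun i => by rw [hu', (hdiag i).2]
  exact ⟨u', U, C, Units.ext <| by rw [hu', hu₀, Units.val_one], hU, hC, hUdiag, hCdiag⟩

namespace HasUnits

theorem plus_apply_eq_zero (h : L.HasUnits u U C) {i j : Fin n} (hij : j < i) : L.plus i j = 0 :=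
  h.plus ▸ U.blockTriangular hij

theorem minus_apply_eq_zero (h : L.HasUnits u U C) {i j : Fin n} (hij : i < j) : L.minus i j = 0 :=
  h.minus ▸ C.blockTriangular hij

theorem plus_apply_self (h : L.HasUnits u U C) (i : Fin n) : L.plus i i = u (i + 1) := by
  rw [← h.plus, ← TriangularUnits.coe_diag, h.diag_plus]

theorem minus_apply_self (h : L.HasUnits u U C) (i : Fin n) : L.minus i i = u i := by
  rw [← h.minus, ← TriangularUnits.coe_diag, h.diag_minus]

theorem isLOperator (h : L.HasUnits u U C) : L.IsLOperator :=
  ⟨fun _ _ => h.plus_apply_eq_zero, fun _ _ => h.minus_apply_eq_zero, fun k => u k,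
    Units.val_eq_one.2 h.zero, fun k => (u k).isUnit,
    fun i => ⟨h.plus_apply_self i, h.minus_apply_self i⟩⟩

end HasUnits

end LPair

end LOperators

section ZeroCurvature

variable {n : ℕ} {R : Type*} [Ring R] {X Y : LPair n R × LPair n R} {u₁ u₂ : ℕ → Rˣ}
  {U₁ U₂ : UpperUnits n R} {C₁ C₂ : LowerUnits n R}

theorem plain_Ioi (k : Fin n) :
    plain (Finset.Ioi k) = (above (increasing n) k).map Function.Embedding.inr := by
  rw [above_increasing, plain]

theorem plain_Iio (k : Fin n) :
    plain (Finset.Iio k) = (above (decreasing n) k).map Function.Embedding.inr := by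
  rw [above_decreasing, plain]

theorem plain_Ici (k : Fin n) :
    plain (Finset.Ici k) = (insert k (above (increasing n) k)).map Function.Embedding.inr := by
  rw [above_increasing, Finset.Ioi_insert, plain]

theorem plain_Iic (k : Fin n) :
    plain (Finset.Iic k) = (insert k (above (decreasing n) k)).map Function.Embedding.inr := by
  rw [above_decreasing, Finset.Iio_insert, plain]

namespace ZeroCurvature

open Sum (inl inr)

theorem hasLeftQP_matM (h : ZeroCurvature X Y) (hY₁ : Y.1.HasUnits u₁ U₁ C₁)
    (hY₂ : Y.2.HasUnits u₂ U₂ C₂) (k : Fin n) {a : Fin n ⊕ Fin n}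
    (ha : a ∉ plain (Finset.Ioi k)) :
    HasLeftQP (matM X) (plain (Finset.Ici k)) (plain (Finset.Ioi k)) (inr k) a
      (↑(u₁ k)⁻¹ * Matrix.fromCols Y.1.plus Y.1.minus k a) := by
  have rows_eq : (matM X).submatrix (Function.Embedding.inr : Fin n ↪ Fin n ⊕ Fin n) id =
      (U₂ : Matrix (Fin n) (Fin n) R) * Matrix.fromCols Y.1.plus Y.1.minus := by
    rw [Matrix.mul_fromCols, hY₂.plus, ← h.1, ← h.2.1]
    ext i (j | j) <;> rfl
  rw [plain_Ioi] at ha ⊢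
  rw [plain_Ici]
  exact hasLeftQP_of_left_factor (c := decreasing n) (g := Function.Embedding.inr)
    (fun _ _ => Iff.rfl) rows_eq hY₁.minus.symm (hY₁.minus_apply_self k) (by simp) ha

theorem hasRightQP_matM (h : ZeroCurvature X Y) (hY₁ : Y.1.HasUnits u₁ U₁ C₁)
    (hY₂ : Y.2.HasUnits u₂ U₂ C₂) (k : Fin n) {a : Fin n ⊕ Fin n}
    (ha : a ∉ plain (Finset.Ioi k)) :
    HasRightQP (matM X) (plain (Finset.Ici k)) (plain (Finset.Ioi k)) a (inl k)
      (Matrix.fromRows Y.2.minus Y.2.plus a k * ↑(u₂ k)⁻¹) := by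
  have cols_eq : (matM X).submatrix id (Function.Embedding.inr : Fin n ↪ Fin n ⊕ Fin n) =
      Matrix.fromRows Y.2.minus Y.2.plus * (C₁ : Matrix (Fin n) (Fin n) R) := by
    rw [Matrix.fromRows_mul, hY₁.minus, ← h.2.1, ← h.2.2]
    ext (i | i) j <;> rfl
  rw [plain_Ioi] at ha ⊢
  rw [plain_Ici]
  exact hasRightQP_of_right_factor (c := decreasing n) (f := Function.Embedding.inr)
    (fun _ _ => Iff.rfl) cols_eq hY₂.plus.symm (hY₂.minus_apply_self k) ha (by simp)

theorem hasLeftQP_matMt (h : ZeroCurvature X Y) (hX₁ : X.1.HasUnits u₁ U₁ C₁)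
    (hX₂ : X.2.HasUnits u₂ U₂ C₂) (k : Fin n) {a : Fin n ⊕ Fin n}
    (ha : a ∉ plain (Finset.Iio k)) :
    HasLeftQP (matMt Y) (plain (Finset.Iic k)) (plain (Finset.Iio k)) (inl k) a
      (↑(u₂ k)⁻¹ * Matrix.fromCols X.2.minus X.2.plus k a) := by
  have rows_eq : (matMt Y).submatrix (Function.Embedding.inr : Fin n ↪ Fin n ⊕ Fin n) id =
      (C₁ : Matrix (Fin n) (Fin n) R) * Matrix.fromCols X.2.minus X.2.plus := by
    rw [Matrix.mul_fromCols, hX₁.minus, h.2.1, h.2.2]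
    ext i (j | j) <;> rfl
  rw [plain_Iio] at ha ⊢
  rw [plain_Iic]
  exact hasLeftQP_of_left_factor (c := increasing n) (g := Function.Embedding.inr)
    (fun _ _ => Iff.rfl) rows_eq hX₂.plus.symm (hX₂.minus_apply_self k) (by simp) ha

theorem hasRightQP_matMt (h : ZeroCurvature X Y) (hX₁ : X.1.HasUnits u₁ U₁ C₁)
    (hX₂ : X.2.HasUnits u₂ U₂ C₂) (k : Fin n) {a : Fin n ⊕ Fin n}
    (ha : a ∉ plain (Finset.Iio k)) :
    HasRightQP (matMt Y) (plain (Finset.Iic k)) (plain (Finset.Iio k)) a (inr k)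
      (Matrix.fromRows X.1.plus X.1.minus a k * ↑(u₁ k)⁻¹) := by
  have cols_eq : (matMt Y).submatrix id (Function.Embedding.inr : Fin n ↪ Fin n ⊕ Fin n) =
      Matrix.fromRows X.1.plus X.1.minus * (U₂ : Matrix (Fin n) (Fin n) R) := by
    rw [Matrix.fromRows_mul, hX₂.plus, h.1, h.2.1]
    ext (i | i) j <;> rfl
  rw [plain_Iio] at ha ⊢
  rw [plain_Iic]
  exact hasRightQP_of_right_factor (c := increasing n) (f := Function.Embedding.inr)
    (fun _ _ => Iff.rfl) cols_eq hX₁.minus.symm (hX₁.minus_apply_self k) ha (by simp)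

theorem forwardDefined (h : ZeroCurvature X Y) (hY₁ : Y.1.HasUnits u₁ U₁ C₁)
    (hY₂ : Y.2.HasUnits u₂ U₂ C₂) : ForwardDefined X := by
  have hq := h.hasLeftQP_matM hY₁ hY₂
  have hr := h.hasRightQP_matM hY₁ hY₂
  exact ⟨fun k => ⟨(hq k (by simp [plain])).1, (hr k (by simp [plain])).1⟩, fun i j hij =>
    ⟨(hq i (by simp [plain])).1, (hq j (by simpa [plain])).1,
      (hr j (by simpa [plain])).1, (hr i (by simp [plain])).1⟩⟩

theorem forwardMap_eq (h : ZeroCurvature X Y) (hY₁ : Y.1.HasUnits u₁ U₁ C₁)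
    (hY₂ : Y.2.HasUnits u₂ U₂ C₂) : forwardMap X = Y := by
  have q_bar (i j) : qM X i (inr i) (inl j) = ↑(u₁ i)⁻¹ * Y.1.plus i j :=
    (h.hasLeftQP_matM hY₁ hY₂ i (by simp [plain])).2
  have q_plain (i j) (hij : j ≤ i) : qM X i (inr i) (inr j) = ↑(u₁ i)⁻¹ * Y.1.minus i j :=
    (h.hasLeftQP_matM hY₁ hY₂ i (by simpa [plain])).2
  have r_bar (i j) : rM X j (inl i) (inl j) = Y.2.minus i j * ↑(u₂ j)⁻¹ :=
    (h.hasRightQP_matM hY₁ hY₂ j (by simp [plain])).2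
  have r_plain (i j) (hij : i ≤ j) : rM X j (inr i) (inl j) = Y.2.plus i j * ↑(u₂ j)⁻¹ :=
    (h.hasRightQP_matM hY₁ hY₂ j (by simpa [plain])).2
  have q_self (k) : qM X k (inr k) (inl k) = ↑(u₁ k)⁻¹ * u₁ (k + 1) := by
    rw [q_bar, hY₁.plus_apply_self]
  have r_self (k) : rM X k (inr k) (inl k) = u₂ (k + 1) * ↑(u₂ k)⁻¹ := by
    rw [r_plain k k le_rfl, hY₂.plus_apply_self]
  refine Prod.ext (LPair.ext ?_ ?_) (LPair.ext ?_ ?_)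
  · exact of_ite_prodRight_mul hY₁.zero q_self (fun i j _ => q_bar i j)
      fun i j hij => hY₁.plus_apply_eq_zero (not_le.1 hij)
  · exact of_ite_prodRight_mul (r := fun j i => i ≤ j) hY₁.zero q_self q_plain
      fun j i hij => hY₁.minus_apply_eq_zero (not_le.1 hij)
  · exact of_ite_mul_prodLeft hY₂.zero r_self r_plain
      fun i j hij => hY₂.plus_apply_eq_zero (not_le.1 hij)
  · exact of_ite_mul_prodLeft (r := fun j i => i ≤ j) hY₂.zero r_self (fun j i _ => r_bar j i)
      fun j i hij => hY₂.minus_apply_eq_zero (not_le.1 hij)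

theorem backwardDefined (h : ZeroCurvature X Y) (hX₁ : X.1.HasUnits u₁ U₁ C₁)
    (hX₂ : X.2.HasUnits u₂ U₂ C₂) : BackwardDefined Y := by
  have hq := h.hasLeftQP_matMt hX₁ hX₂
  have hr := h.hasRightQP_matMt hX₁ hX₂
  exact ⟨fun k => ⟨(hq k (by simp [plain])).1, (hr k (by simp [plain])).1⟩, fun i j hij =>
    ⟨(hr j (by simp [plain])).1, (hr i (by simpa [plain])).1,
      (hq i (by simpa [plain])).1, (hq j (by simp [plain])).1⟩⟩

theorem backwardMap_eq (h : ZeroCurvature X Y) (hX₁ : X.1.HasUnits u₁ U₁ C₁)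
    (hX₂ : X.2.HasUnits u₂ U₂ C₂) : backwardMap Y = X := by
  have q_bar (i j) : qMt Y i (inl i) (inl j) = ↑(u₂ i)⁻¹ * X.2.minus i j :=
    (h.hasLeftQP_matMt hX₁ hX₂ i (by simp [plain])).2
  have q_plain (i j) (hij : i ≤ j) : qMt Y i (inl i) (inr j) = ↑(u₂ i)⁻¹ * X.2.plus i j :=
    (h.hasLeftQP_matMt hX₁ hX₂ i (by simpa [plain])).2
  have r_bar (i j) : rMt Y j (inl i) (inr j) = X.1.plus i j * ↑(u₁ j)⁻¹ :=
    (h.hasRightQP_matMt hX₁ hX₂ j (by simp [plain])).2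
  have r_plain (i j) (hij : j ≤ i) : rMt Y j (inr i) (inr j) = X.1.minus i j * ↑(u₁ j)⁻¹ :=
    (h.hasRightQP_matMt hX₁ hX₂ j (by simpa [plain])).2
  have q_self (k) : qMt Y k (inl k) (inr k) = ↑(u₂ k)⁻¹ * u₂ (k + 1) := by
    rw [q_plain k k le_rfl, hX₂.plus_apply_self]
  have r_self (k) : rMt Y k (inl k) (inr k) = u₁ (k + 1) * ↑(u₁ k)⁻¹ := by
    rw [r_bar, hX₁.plus_apply_self]
  refine Prod.ext (LPair.ext ?_ ?_) (LPair.ext ?_ ?_)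
  · exact of_ite_mul_prodLeft hX₁.zero r_self (fun i j _ => r_bar i j)
      fun i j hij => hX₁.plus_apply_eq_zero (not_le.1 hij)
  · exact of_ite_mul_prodLeft (r := fun j i => i ≤ j) hX₁.zero r_self r_plain
      fun j i hij => hX₁.minus_apply_eq_zero (not_le.1 hij)
  · exact of_ite_prodRight_mul hX₂.zero q_self q_plain
      fun i j hij => hX₂.plus_apply_eq_zero (not_le.1 hij)
  · exact of_ite_prodRight_mul (r := fun j i => i ≤ j) hX₂.zero q_self (fun j i _ => q_bar j i)
      fun j i hij => hX₂.minus_apply_eq_zero (not_le.1 hij)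

theorem forwardDomain (h : ZeroCurvature X Y) (hX₁ : X.1.IsLOperator) (hX₂ : X.2.IsLOperator)
    (hY₁ : Y.1.HasUnits u₁ U₁ C₁) (hY₂ : Y.2.HasUnits u₂ U₂ C₂) : ForwardDomain X := by
  refine ⟨hX₁, hX₂, fun k => ?_⟩
  obtain ⟨hdef, heq⟩ := hasQuasidet_mul_self (c := decreasing n) (fun _ _ => Iff.rfl) U₂ C₁ k
  rw [hY₁.minus, hY₂.plus, ← h.2.1, above_increasing, Finset.Ioi_insert] at hdef heq
  exact ⟨hdef, heq ▸ Units.isUnit _⟩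

theorem backwardDomain (h : ZeroCurvature X Y) (hY₁ : Y.1.IsLOperator) (hY₂ : Y.2.IsLOperator)
    (hX₁ : X.1.HasUnits u₁ U₁ C₁) (hX₂ : X.2.HasUnits u₂ U₂ C₂) : BackwardDomain Y := by
  refine ⟨hY₁, hY₂, fun k => ?_⟩
  obtain ⟨hdef, heq⟩ := hasQuasidet_mul_self (c := increasing n) (fun _ _ => Iff.rfl) C₁ U₂ k
  rw [hX₁.minus, hX₂.plus, h.2.1, above_decreasing, Finset.Iio_insert] at hdef heq
  exact ⟨hdef, heq ▸ Units.isUnit _⟩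

end ZeroCurvature

end ZeroCurvature

section Existence

/-- The conditions that zero curvature imposes on the diagonals of the new L-operators, solved
alternately for `a k` and `b (k + 1)`. -/
theorem exists_succ_mul_eq {G : Type*} [Group G] {n : ℕ} (c : ℕ → G) (d : Fin n → G)
    (hc : c 0 = 1) : ∃ a b : ℕ → G, a 0 = 1 ∧ b 0 = 1 ∧ (∀ k, b k * a k = c k) ∧
      ∀ k : Fin n, b (k + 1) * a k = d k := by
  let b : ℕ → G := fun k => Nat.rec 1
    (fun k x => if hk : k < n then d ⟨k, hk⟩ * (x⁻¹ * c k)⁻¹ else 1) k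
  have hb (k : Fin n) : b (k + 1) = d k * ((b k)⁻¹ * c k)⁻¹ := dif_pos k.isLt
  refine ⟨fun k => (b k)⁻¹ * c k, b, by simp [b, hc], rfl, fun k => mul_inv_cancel_left _ _,
    fun k => ?_⟩
  rw [hb, inv_mul_cancel_right]

theorem exists_mul_succ_eq {G : Type*} [Group G] {n : ℕ} (c : ℕ → G) (d : Fin n → G)
    (hc : c 0 = 1) : ∃ a b : ℕ → G, a 0 = 1 ∧ b 0 = 1 ∧ (∀ k, a k * b k = c k) ∧
      ∀ k : Fin n, a k * b (k + 1) = d k := by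
  obtain ⟨a, b, ha, hb, hab, hab'⟩ := exists_succ_mul_eq c⁻¹ d⁻¹ (by simp [hc])
  refine ⟨a⁻¹, b⁻¹, by simp [ha], by simp [hb], fun k => ?_, fun k => ?_⟩
  · simpa [mul_inv_rev] using congrArg (·⁻¹) (hab k)
  · simpa [mul_inv_rev] using congrArg (·⁻¹) (hab' k)

variable {n : ℕ} {R : Type*} [Ring R] {X Y : LPair n R × LPair n R}

theorem ForwardDomain.exists_zeroCurvature (hX : ForwardDomain X) :
    ∃ Y : LPair n R × LPair n R, Y.1.IsLOperator ∧ Y.2.IsLOperator ∧ ZeroCurvature X Y := by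
  obtain ⟨hX₁, hX₂, hJ⟩ := hX
  obtain ⟨u₁, U₁, C₁, hX₁⟩ := hX₁.exists_hasUnits
  obtain ⟨u₂, U₂, C₂, hX₂⟩ := hX₂.exists_hasUnits
  choose d hd using fun k => (hJ k).2
  obtain ⟨v₁, v₂, hv₁, hv₂, hv, hvd⟩ := exists_succ_mul_eq (fun k => u₁ k * u₂ k) d
    (by simp [hX₁.zero, hX₂.zero])
  obtain ⟨V₂, D₁, hJ_eq, hV₂, hD₁⟩ := exists_gaussDecomposition (b := increasing n)
    (c := decreasing n) (J := X.1.minus * X.2.plus) (d := d) (fun _ _ => Iff.rfl)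
    (fun k => by
      rw [above_increasing, Finset.Ioi_insert]
      exact ⟨(hJ k).1, (hd k).symm⟩)
    (fun k => v₂ (k + 1))
  have hD₁ : TriangularUnits.diag D₁ = fun k : Fin n => v₁ k :=
    hD₁.trans <| funext fun k => inv_mul_eq_of_eq_mul (hvd k).symm
  have hV₁ : TriangularUnits.diag (V₂⁻¹ * (U₁ * U₂)) = fun k : Fin n => v₁ (k + 1) := by
    rw [map_mul, map_mul, map_inv, hV₂, hX₁.diag_plus, hX₂.diag_plus]
    exact funext fun k => inv_mul_eq_of_eq_mul (hv (k + 1)).symm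
  have hD₂ : TriangularUnits.diag (C₁ * C₂ * D₁⁻¹) = fun k : Fin n => v₂ k := by
    rw [map_mul, map_mul, map_inv, hD₁, hX₁.diag_minus, hX₂.diag_minus]
    exact funext fun k => mul_inv_eq_of_eq_mul (hv k).symm
  refine ⟨(⟨↑(V₂⁻¹ * (U₁ * U₂)), D₁⟩, ⟨V₂, ↑(C₁ * C₂ * D₁⁻¹)⟩),
    LPair.HasUnits.isLOperator ⟨hv₁, rfl, rfl, hV₁, hD₁⟩,
    LPair.HasUnits.isLOperator ⟨hv₂, rfl, rfl, hV₂, hD₂⟩, ?_, hJ_eq.symm, ?_⟩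
  · rw [← hX₁.plus, ← hX₂.plus]
    exact congrArg (fun W : UpperUnits n R => (W : Matrix (Fin n) (Fin n) R))
      (mul_inv_cancel_left V₂ (U₁ * U₂)).symm
  · rw [← hX₁.minus, ← hX₂.minus]
    exact congrArg (fun W : LowerUnits n R => (W : Matrix (Fin n) (Fin n) R))
      (inv_mul_cancel_right (C₁ * C₂) D₁).symm

theorem BackwardDomain.exists_zeroCurvature (hY : BackwardDomain Y) :
    ∃ X : LPair n R × LPair n R, X.1.IsLOperator ∧ X.2.IsLOperator ∧ ZeroCurvature X Y := by
  obtain ⟨hY₁, hY₂, hJ⟩ := hY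
  obtain ⟨v₁, V₁, D₁, hY₁⟩ := hY₁.exists_hasUnits
  obtain ⟨v₂, V₂, D₂, hY₂⟩ := hY₂.exists_hasUnits
  choose d hd using fun k => (hJ k).2
  obtain ⟨u₁, u₂, hu₁, hu₂, hu, hud⟩ := exists_mul_succ_eq (fun k => v₂ k * v₁ k) d
    (by simp [hY₁.zero, hY₂.zero])
  obtain ⟨C₁, U₂, hJ_eq, hC₁, hU₂⟩ := exists_gaussDecomposition (b := decreasing n)
    (c := increasing n) (J := Y.2.plus * Y.1.minus) (d := d) (fun _ _ => Iff.rfl)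
    (fun k => by
      rw [above_decreasing, Finset.Iio_insert]
      exact ⟨(hJ k).1, (hd k).symm⟩)
    (fun k => u₁ k)
  have hU₂ : TriangularUnits.diag U₂ = fun k : Fin n => u₂ (k + 1) :=
    hU₂.trans <| funext fun k => inv_mul_eq_of_eq_mul (hud k).symm
  have hU₁ : TriangularUnits.diag (V₂ * V₁ * U₂⁻¹) = fun k : Fin n => u₁ (k + 1) := by
    rw [map_mul, map_mul, map_inv, hU₂, hY₁.diag_plus, hY₂.diag_plus]
    exact funext fun k => mul_inv_eq_of_eq_mul (hu (k + 1)).symm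
  have hC₂ : TriangularUnits.diag (C₁⁻¹ * (D₂ * D₁)) = fun k : Fin n => u₂ k := by
    rw [map_mul, map_mul, map_inv, hC₁, hY₁.diag_minus, hY₂.diag_minus]
    exact funext fun k => inv_mul_eq_of_eq_mul (hu k).symm
  refine ⟨(⟨↑(V₂ * V₁ * U₂⁻¹), C₁⟩, ⟨U₂, ↑(C₁⁻¹ * (D₂ * D₁))⟩),
    LPair.HasUnits.isLOperator ⟨hu₁, rfl, rfl, hU₁, hC₁⟩,
    LPair.HasUnits.isLOperator ⟨hu₂, rfl, rfl, hU₂, hC₂⟩, ?_, hJ_eq, ?_⟩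
  · rw [← hY₁.plus, ← hY₂.plus]
    exact congrArg (fun W : UpperUnits n R => (W : Matrix (Fin n) (Fin n) R))
      (inv_mul_cancel_right (V₂ * V₁) U₂)
  · rw [← hY₁.minus, ← hY₂.minus]
    exact congrArg (fun W : LowerUnits n R => (W : Matrix (Fin n) (Fin n) R))
      (mul_inv_cancel_left C₁ (D₂ * D₁))

end Existence

theorem theorem2p6 {R : Type*} [Ring R] (n : ℕ) :
    (∀ Y : LPair n R × LPair n R, BackwardDomain Y →
      BackwardDefined Y ∧ ForwardDomain (backwardMap Y) ∧
      ZeroCurvature (backwardMap Y) Y ∧ forwardMap (backwardMap Y) = Y) ∧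
    (∀ X : LPair n R × LPair n R, ForwardDomain X →
      ForwardDefined X ∧ BackwardDomain (forwardMap X) ∧
      ZeroCurvature X (forwardMap X) ∧ backwardMap (forwardMap X) = X) := by
  constructor
  · intro Y hY
    obtain ⟨X, hX₁, hX₂, h⟩ := hY.exists_zeroCurvature
    obtain ⟨_, _, _, hX₁'⟩ := hX₁.exists_hasUnits
    obtain ⟨_, _, _, hX₂'⟩ := hX₂.exists_hasUnits
    obtain ⟨_, _, _, hY₁'⟩ := hY.1.exists_hasUnits
    obtain ⟨_, _, _, hY₂'⟩ := hY.2.1.exists_hasUnits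
    rw [h.backwardMap_eq hX₁' hX₂']
    exact ⟨h.backwardDefined hX₁' hX₂', h.forwardDomain hX₁ hX₂ hY₁' hY₂', h,
      h.forwardMap_eq hY₁' hY₂'⟩
  · intro X hX
    obtain ⟨Y, hY₁, hY₂, h⟩ := hX.exists_zeroCurvature
    obtain ⟨_, _, _, hX₁'⟩ := hX.1.exists_hasUnits
    obtain ⟨_, _, _, hX₂'⟩ := hX.2.1.exists_hasUnits
    obtain ⟨_, _, _, hY₁'⟩ := hY₁.exists_hasUnits
    obtain ⟨_, _, _, hY₂'⟩ := hY₂.exists_hasUnits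
    rw [h.forwardMap_eq hY₁' hY₂']
    exact ⟨h.forwardDefined hY₁' hY₂', h.backwardDomain hY₁ hY₂ hX₁' hX₂', h,
      h.backwardMap_eq hX₁' hX₂'⟩
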